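/- Let $n \ge 3$ and let $h$ be a hermitian form of signature $(n-1,1)$ on $\mathbb{C}^n$, conjugate-linear in the first variable and linear in the second. Let $\mathrm{SU}(h) \subset \mathrm{SL}_n(\mathbb{C})$ be the group of matrices of determinant $1$ preserving $h$ (so $\mathrm{SU}(h) \cong \mathrm{SU}(n-1,1)$). A triple of flags $(L_i \subset H_i)_{i=1,2,3}$, with $L_i$ a line and $H_i$ a hyperplane of $\mathbb{C}^n$, is called semi-stable if for some $d \ge 1$ there is an $\mathrm{SL}_n(\mathbb{C})$-invariant global section, not vanishing at it, of the $d$-th power of the restriction of $\mathcal{O}(1,1) \boxtimes \mathcal{O}(1,1) \boxtimes \mathcal{O}(1,1)$ to the variety of triples of flags, embedded in $(\mathbb{P}(\mathbb{C}^n) \times \mathbb{P}((\mathbb{C}^n)^\vee))^3$. A triple $(L_1, L_2, L_3)$ of $h$-isotropic lines is called semi-stable if the triple of flags $(L_i \subset L_i^\perp)_{i=1,2,3}$ is. Let $X^{ss}$ be the space of semi-stable triples of isotropic lines, with the topology induced by $\mathbb{P}(\mathbb{C}^n)^3$; the group $\mathrm{SU}(h)$ acts on it. Then for every $x \in X^{ss}$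 the closure in $X^{ss}$ of the orbit $\mathrm{SU}(h)\cdot x$ contains a unique closed orbit $q(x)$. Let $X^{ss}/\mathrm{SU}(h)$ (the separated quotient) be the set of closed orbits in $X^{ss}$, endowed with the finest topology for which $q \colon X^{ss} \to X^{ss}/\mathrm{SU}(h)$ is continuous. For every semi-stable triple $x = (L_1,L_2,L_3)$ of isotropic lines and all generators $v_i$ of $L_i$, the number $h(v_1,v_3)\,h(v_3,v_2)\,h(v_2,v_1)$ is non-zero, and its argument $$ p(x) = \frac{h(v_1,v_3)\,h(v_3,v_2)\,h(v_2,v_1)}{|h(v_1,v_3)\,h(v_3,v_2)\,h(v_2,v_1)|} $$ does not depend on the choice of the generators. The map $p$ induces, through $q$, a homeomorphism of $X^{ss}/\mathrm{SU}(h)$ onto the closed half-circle $$ \{ u \in \mathrm{U}(1) : \mathrm{Re}(u) \le 0 \}. $$ -/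

import Mathlib

open scoped LinearAlgebra.Projectivization Matrix

/-- The quotient topology on the complex projective space of lines of `ℂⁿ`. -/
noncomputable instance projectiveSpaceTopology (n : ℕ) : TopologicalSpace (ℙ ℂ (Fin n → ℂ)) :=
  TopologicalSpace.coinduced (Projectivization.mk' (V := Fin n → ℂ) ℂ) inferInstance

/-- Sesquilinear forms on `ℂⁿ`, conjugate-linear in the first variable and linear in the second. -/
abbrev SesqForm (n : ℕ) : Type := (Fin n → ℂ) →ₗ⋆[ℂ] (Fin n → ℂ) →ₗ[ℂ] ℂ

/-- `h` is a hermitian form of signature `(p, q)`: it has an orthogonal basis with `p` vectors of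
square `1` and `q` vectors of square `-1`. -/
def HasSignature {n : ℕ} (h : SesqForm n) (p q : ℕ) : Prop :=
  (∀ v w, starRingEnd ℂ (h v w) = h w v) ∧
    ∃ b : Module.Basis (Fin p ⊕ Fin q) ℂ (Fin n → ℂ), ∀ i j,
      h (b i) (b j) = if i = j then Sum.elim (fun _ => 1) (fun _ => -1) i else 0

/-- The special unitary group of `h`: the matrices of determinant `1` preserving `h`. -/
def specialUnitary {n : ℕ} (h : SesqForm n) : Subgroup (Matrix.SpecialLinearGroup (Fin n) ℂ) where
  carrier := {g | ∀ v w, h (g • v) (g • w) = h v w}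
  one_mem' := fun v w => by simp
  mul_mem' := fun {a b} ha hb v w => by rw [mul_smul, mul_smul, ha, hb]
  inv_mem' := fun {a} ha v w => by
    have := ha (a⁻¹ • v) (a⁻¹ • w)
    rwa [smul_inv_smul, smul_inv_smul, eq_comm] at this

/-! ### Semi-stability

A flag `L ⊆ H` (line, hyperplane) of `ℂⁿ` is given by a generator `v` of `L` and by the coefficients
`φ` of an equation of `H`, with `φ ⬝ᵥ v = 0`. An `r`-tuple of flags is thus given by
`v φ : Fin r → Fin n → ℂ`. -/

/-- The coordinates of the point `(v₁, φ₁), …, (v_r, φ_r)` of `(ℂⁿ × (ℂⁿ)ᵛ)ʳ`; the left summand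
indexes the coordinates of the vectors, the right one those of the linear forms. -/
def flagCoord {n r : ℕ} (v φ : Fin r → Fin n → ℂ) : (Fin r × Fin n) ⊕ (Fin r × Fin n) → ℂ :=
  Sum.elim (fun k => v k.1 k.2) (fun k => φ k.1 k.2)

/-- `P` is homogeneous of degree `d` separately in each of the vectors `v₁, …, v_r` and in each of
the linear forms `φ₁, …, φ_r`. -/
def IsMultihomogeneous {n r : ℕ} (d : ℕ)
    (P : MvPolynomial ((Fin r × Fin n) ⊕ (Fin r × Fin n)) ℂ) : Prop :=
  ∀ m ∈ P.support, ∀ i, ∑ j, m (Sum.inl (i, j)) = d ∧ ∑ j, m (Sum.inr (i, j)) = d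

/-- `P` defines an `SL_n(ℂ)`-invariant global section, on the variety of `r`-tuples of flags
(line, hyperplane) of `ℂⁿ`, of the `d`-th power of the restriction of the line bundle
`𝒪(1,1) ⊠ ⋯ ⊠ 𝒪(1,1)` on `(ℙ(ℂⁿ) × ℙ((ℂⁿ)ᵛ))ʳ`. The group acts by `g • (v, φ) = (g v, φ ∘ g⁻¹)`. -/
def IsInvariantSection {n r : ℕ} (d : ℕ)
    (P : MvPolynomial ((Fin r × Fin n) ⊕ (Fin r × Fin n)) ℂ) : Prop :=
  IsMultihomogeneous d P ∧
    ∀ (g : Matrix.SpecialLinearGroup (Fin n) ℂ) (v φ : Fin r → Fin n → ℂ),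
      (∀ i, φ i ⬝ᵥ v i = 0) →
        MvPolynomial.eval
            (flagCoord (fun i => g • v i) (fun i => φ i ᵥ* (↑g⁻¹ : Matrix (Fin n) (Fin n) ℂ))) P
          = MvPolynomial.eval (flagCoord v φ) P

/-- Semi-stability, under `SL_n(ℂ)` and with respect to `𝒪(1,1) ⊠ ⋯ ⊠ 𝒪(1,1)`, of the `r`-tuple of
flags with generators `v i` and equations `φ i`: some invariant section of a positive power of the
line bundle does not vanish there. -/
def IsSemistable {n r : ℕ} (v φ : Fin r → Fin n → ℂ) : Prop :=
  ∃ d : ℕ, 1 ≤ d ∧ ∃ P, IsInvariantSection d P ∧ MvPolynomial.eval (flagCoord v φ) P ≠ 0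

/-- The coefficients of the linear form `w ↦ h v w`, an equation of the orthogonal of `v`. -/
def orthCovector {n : ℕ} (h : SesqForm n) (v : Fin n → ℂ) : Fin n → ℂ :=
  fun j => h v (Pi.single j 1)

theorem orthCovector_dotProduct {n : ℕ} (h : SesqForm n) (v w : Fin n → ℂ) :
    orthCovector h v ⬝ᵥ w = h v w := by
  conv_rhs => rw [← Finset.univ_sum_single w, map_sum]
  refine Finset.sum_congr rfl fun j _ => ?_
  rw [orthCovector, mul_comm, ← smul_eq_mul, ← map_smul, ← Pi.single_smul, smul_eq_mul, mul_one]

theorem orthCovector_smul {n : ℕ} (h : SesqForm n) {g : Matrix.SpecialLinearGroup (Fin n) ℂ}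
    (hg : g ∈ specialUnitary h) (v : Fin n → ℂ) :
    orthCovector h (g • v) = orthCovector h v ᵥ* (↑g⁻¹ : Matrix (Fin n) (Fin n) ℂ) := by
  funext j
  have h1 := hg v (g⁻¹ • Pi.single j 1)
  rw [smul_inv_smul] at h1
  have h2 : (orthCovector h v ᵥ* (↑g⁻¹ : Matrix (Fin n) (Fin n) ℂ)) j
      = (orthCovector h v ᵥ* (↑g⁻¹ : Matrix (Fin n) (Fin n) ℂ)) ⬝ᵥ Pi.single j 1 := by simp
  rw [h2, ← Matrix.dotProduct_mulVec]
  exact h1.trans (orthCovector_dotProduct h v _).symm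

/-- `v i` is a generator of the line `x i`, for all `i`. -/
def IsGenerators {n r : ℕ} (v : Fin r → Fin n → ℂ) (x : Fin r → ℙ ℂ (Fin n → ℂ)) : Prop :=
  ∀ i, v i ≠ 0 ∧ v i ∈ (x i).submodule

theorem smul_mem_submodule_smul {n : ℕ} (g : Matrix.SpecialLinearGroup (Fin n) ℂ)
    (L : ℙ ℂ (Fin n → ℂ)) {w : Fin n → ℂ} (hw : w ∈ L.submodule) : g • w ∈ (g • L).submodule := by
  induction L with
  | h u hu =>
    rw [Projectivization.smul_mk, Projectivization.submodule_mk, Submodule.mem_span_singleton]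
    rw [Projectivization.submodule_mk, Submodule.mem_span_singleton] at hw
    obtain ⟨a, rfl⟩ := hw
    exact ⟨a, (smul_comm g a u).symm⟩

/-- The space of semi-stable `r`-tuples of isotropic lines `L₁, …, L_r`, with its action of the
special unitary group of `h`; the isotropic line `L` is identified with the flag `L ⊆ Lᗮ`. Its
topology is the one induced by the product of the projective spaces. -/
def semistableIsotropic {n : ℕ} (h : SesqForm n) (r : ℕ) :
    SubMulAction (specialUnitary h) (Fin r → ℙ ℂ (Fin n → ℂ)) where
  carrier := {x | (∀ i, ∀ v ∈ (x i).submodule, h v v = 0) ∧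
    ∃ v, IsGenerators v x ∧ IsSemistable v (fun i => orthCovector h (v i))}
  smul_mem' := by
    rintro ⟨g, hg⟩ x ⟨hx, v, hv, d, hd, P, hP, hne⟩
    refine ⟨fun i w hw => ?_, fun i => g • v i,
      fun i => ⟨(smul_ne_zero_iff_ne g).mpr (hv i).1, smul_mem_submodule_smul g _ (hv i).2⟩,
      d, hd, P, hP, ?_⟩
    · have h1 : g⁻¹ • w ∈ (g⁻¹ • (g • x i)).submodule := smul_mem_submodule_smul g⁻¹ _ hw
      rw [inv_smul_smul] at h1
      have h2 := hg (g⁻¹ • w) (g⁻¹ • w)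
      rw [smul_inv_smul, hx i _ h1] at h2
      exact h2
    · have h1 := hP.2 g v (fun i => orthCovector h (v i))
        (fun i => by rw [orthCovector_dotProduct]; exact hx i _ (hv i).2)
      have h2 : (fun i => orthCovector h (g • v i))
          = fun i => orthCovector h (v i) ᵥ* (↑g⁻¹ : Matrix (Fin n) (Fin n) ℂ) :=
        funext fun i => orthCovector_smul h hg (v i)
      rw [h2, h1]
      exact hne

/-! ### The separated quotient -/

/-- The set of closed orbits of a group acting on a topological space. -/
def ClosedOrbit (G X : Type*) [Group G] [MulAction G X] [TopologicalSpace X] : Type _ :=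
  {O : Set X // IsClosed O ∧ ∃ x, O = MulAction.orbit G x}

/-- `q` is the canonical projection onto the set of closed orbits: `q x` is the unique closed orbit
contained in the closure of the orbit of `x`. -/
def IsClosedOrbitProjection {G X : Type*} [Group G] [MulAction G X] [TopologicalSpace X]
    (q : X → ClosedOrbit G X) : Prop :=
  ∀ (x : X) (O : ClosedOrbit G X), O.1 ⊆ closure (MulAction.orbit G x) ↔ O = q x

/-- The closed half-circle `{u ∈ U(1) : Re u ≤ 0}`. -/
def halfCircle : Set Circle := {u | (u : ℂ).re ≤ 0}

/-!
A triple of isotropic lines with generators `v₁, v₂, v₃` is semi-stable if and only if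
`T = h(v₁, v₃) h(v₃, v₂) h(v₂, v₁)` is nonzero. If `T ≠ 0`, it is the value at the triple of flags
of the invariant section `φ₁(v₃) φ₃(v₂) φ₂(v₁)` (`isSemistable_of_tripleProduct_ne_zero`). If
`T = 0`, two of the lines are orthogonal, hence equal because the signature is `(n - 1, 1)`. An
isometry which acts by `2` on this line and by `2` or `1 / 2` on the third one multiplies the value
of every invariant section of degree `d ≥ 1` by a number greater than `1`, and also preserves it, so
that this value is `0` (`HasSignature.apply_ne_zero_of_isSemistable`).

On the semi-stable triples, the argument of `T` is continuous, since the projective space is an open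
quotient of the nonzero vectors (`continuousAt_angularInvariant`). Its values satisfy `Re ≤ 0`,
since the orthogonal of the plane of `v₁` and `v₂` is positive definite
(`HasSignature.re_tripleProduct_nonpos`). Its fibres are exactly the orbits of the special unitary
group: two triples with the same argument have generators with the same Gram matrix, and then
complex reflections move one to the other (`HasSignature.exists_preservesForm_triple`); the
determinant is corrected by a unit scalar, which acts trivially on lines.

Hence all orbits are closed, the separated quotient is the set of all orbits, and the argument of
`T` induces a continuous bijection of it onto the half-circle. The inverse is continuous because
the argument has a continuous section, `u ↦ (e₁, e₂, e₁ + u e₂ + √(-2 Re u) e₃)`, where `e₁, e₂` are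
isotropic with `h(e₁, e₂) = 1` and `e₃` is a unit vector orthogonal to both
(`HasSignature.exists_tripleProduct_eq`).
-/

/-! ### Forms of signature `(p, 1)` -/

namespace HasSignature

variable {n p : ℕ} {h : SesqForm n}

/-- The last coordinate in an adapted basis is a linear form whose kernel is positive definite. -/
theorem exists_posDef_ker (hh : HasSignature h p 1) :
    ∃ T : (Fin n → ℂ) →ₗ[ℂ] ℂ, ∀ w, T w = 0 → w ≠ 0 → 0 < (h w w).re := by
  obtain ⟨-, b, hb⟩ := hh
  refine ⟨b.coord (Sum.inr 0), fun w hw hw0 => ?_⟩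
  have key : h w w = ∑ i, ((‖b.repr w (Sum.inl i)‖ ^ 2 : ℝ) : ℂ) := by
    conv_lhs => rw [← b.sum_repr w]
    simp only [map_sum, LinearMap.sum_apply, map_smulₛₗ, LinearMap.smul_apply, hb,
      smul_eq_mul, mul_ite, mul_zero]
    rw [Module.Basis.coord_apply] at hw
    simp only [Finset.sum_ite_eq', Fintype.sum_sum_type, Finset.mem_univ, if_true]
    simp [hw, ← Complex.mul_conj', mul_comm]
  have hne : ∃ i, b.repr w (Sum.inl i) ≠ 0 := by
    by_contra! hc
    refine hw0 (b.repr.map_eq_zero_iff.mp (Finsupp.ext fun i => ?_))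
    rcases i with i | i
    · exact hc i
    · rw [Subsingleton.elim i 0]
      exact hw
  obtain ⟨i, hi⟩ := hne
  rw [key, ← Complex.ofReal_sum, Complex.ofReal_re]
  exact Finset.sum_pos' (fun _ _ => by positivity) ⟨i, Finset.mem_univ _, by positivity⟩

theorem apply_eq_zero_comm (hh : HasSignature h p 1) {v w : Fin n → ℂ} :
    h v w = 0 ↔ h w v = 0 := by
  rw [← hh.1 w v, map_eq_zero]

/-- A totally isotropic subspace has dimension at most `1`. -/
theorem exists_eq_smul (hh : HasSignature h p 1) {v w : Fin n → ℂ} (hv0 : v ≠ 0)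
    (hv : h v v = 0) (hw : h w w = 0) (hvw : h v w = 0) : ∃ c : ℂ, w = c • v := by
  obtain ⟨T, hT⟩ := hh.exists_posDef_ker
  have hTv : T v ≠ 0 := fun h0 => by simpa [hv] using hT v h0 hv0
  refine ⟨T w / T v, ?_⟩
  by_contra hne
  have h1 := hT (w - (T w / T v) • v) (by simp [hTv]) (sub_ne_zero.mpr hne)
  simp [hv, hw, hvw, hh.apply_eq_zero_comm.mp hvw] at h1

/-- The form is positive semi-definite on the orthogonal of an isotropic vector `v`: modulo `v`,
every vector of it lies in a positive definite hyperplane. -/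
theorem re_apply_self_nonneg (hh : HasSignature h p 1) {v w : Fin n → ℂ} (hv0 : v ≠ 0)
    (hv : h v v = 0) (hvw : h v w = 0) : 0 ≤ (h w w).re := by
  obtain ⟨T, hT⟩ := hh.exists_posDef_ker
  have hTv : T v ≠ 0 := fun h0 => by simpa [hv] using hT v h0 hv0
  have h2 : h (w - (T w / T v) • v) (w - (T w / T v) • v) = h w w := by
    simp [hv, hvw, hh.apply_eq_zero_comm.mp hvw]
  rw [← h2]
  by_cases h0 : w - (T w / T v) • v = 0
  · simp [h0]
  · exact (hT _ (by simp [hTv]) h0).le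

/-- Two isotropic vectors with product `1`, and a unit vector orthogonal to both. -/
theorem exists_isotropic_pair (hh : HasSignature h p 1) (hp : 2 ≤ p) :
    ∃ e₁ e₂ e₃ : Fin n → ℂ, h e₁ e₁ = 0 ∧ h e₂ e₂ = 0 ∧ h e₁ e₂ = 1 ∧ h e₃ e₃ = 1 ∧
      h e₁ e₃ = 0 ∧ h e₂ e₃ = 0 := by
  obtain ⟨-, b, hb⟩ := hh
  refine ⟨b (Sum.inl ⟨0, by lia⟩) + b (Sum.inr 0),
    (2⁻¹ : ℂ) • (b (Sum.inl ⟨0, by lia⟩) - b (Sum.inr 0)), b (Sum.inl ⟨1, by lia⟩), ?_⟩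
  simp [hb]
  norm_num

end HasSignature

/-! ### Complex reflections and Witt's theorem for isotropic vectors -/

/-- A linear map preserving the form `h`. -/
def PreservesForm {n : ℕ} (h : SesqForm n) (f : (Fin n → ℂ) →ₗ[ℂ] (Fin n → ℂ)) : Prop :=
  ∀ x y, h (f x) (f y) = h x y

theorem PreservesForm.comp {n : ℕ} {h : SesqForm n} {f g : (Fin n → ℂ) →ₗ[ℂ] (Fin n → ℂ)}
    (hf : PreservesForm h f) (hg : PreservesForm h g) : PreservesForm h (f ∘ₗ g) :=
  fun x y => by rw [LinearMap.comp_apply, LinearMap.comp_apply, hf, hg]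

namespace HasSignature

variable {n p : ℕ} {h : SesqForm n}

/-- The complex reflection along `v - v'` which maps the isotropic vector `v` to the isotropic
vector `v'`. It fixes the orthogonal of `v - v'`, and swaps `v` and `v'` if `h v v'` is real. -/
theorem exists_reflection (hh : HasSignature h p 1) {v v' : Fin n → ℂ} (hv : h v v = 0)
    (hv' : h v' v' = 0) (hne : h v' v ≠ 0) :
    ∃ s, PreservesForm h s ∧ s v = v' ∧ (∀ x, h v x = h v' x → s x = x) ∧
      (h v v' = h v' v → s v' = v) := by
  refine ⟨LinearMap.id + (h v' v)⁻¹ • (h (v - v')).smulRight (v - v'), fun x y => ?_, ?_, ?_, ?_⟩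
  · have hne' : h v v' ≠ 0 := mt hh.apply_eq_zero_comm.mp hne
    have e1 := hh.1 v' v
    have e2 := hh.1 v x
    have e3 := hh.1 v' x
    simp only [LinearMap.add_apply, LinearMap.id_apply, LinearMap.smul_apply,
      LinearMap.smulRight_apply, map_add, map_smulₛₗ, map_sub, LinearMap.sub_apply, smul_eq_mul,
      map_inv₀, e1, e2, e3, hv, hv', RingHom.id_apply]
    field_simp
    ring
  · simp [hv, hne]
  · intro x hx
    simp [hx]
  · intro hx
    simp [hv', hx, hne]

/-- If the products of `a` and `a'` with some vector are equal and nonzero, then an isometry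
fixing the orthogonal of `a - a'` maps `a` to `a'`. -/
theorem exists_preservesForm_fixing (hh : HasSignature h p 1) {a a' w : Fin n → ℂ}
    (ha : h a a = 0) (ha' : h a' a' = 0) (hw : h w a = h w a') (hw0 : h w a ≠ 0) :
    ∃ s, PreservesForm h s ∧ s a = a' ∧ ∀ x, h a x = h a' x → s x = x := by
  by_cases hne : h a' a = 0
  · have ha0 : a' ≠ 0 := by
      rintro rfl
      simp [hw] at hw0
    obtain ⟨c, rfl⟩ := hh.exists_eq_smul ha0 ha' ha hne
    refine ⟨LinearMap.id, fun x y => rfl, ?_, fun x _ => rfl⟩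
    have hc : c = 1 := by
      rw [map_smul, smul_eq_mul] at hw hw0
      exact mul_right_cancel₀ (right_ne_zero_of_mul hw0) (hw.trans (one_mul _).symm)
    simp [hc]
  · obtain ⟨s, h1, h2, h3, -⟩ := hh.exists_reflection ha ha' hne
    exact ⟨s, h1, h2, h3⟩

/-- Triples of pairwise non-orthogonal isotropic vectors with the same Gram matrix are related by
an isometry: a complex reflection moves each vector in turn to its target and fixes the vectors
which are already in place. -/
theorem exists_preservesForm_triple (hh : HasSignature h p 1) {v v' : Fin 3 → Fin n → ℂ}
    (hv : ∀ i, h (v i) (v i) = 0) (hv' : ∀ i, h (v' i) (v' i) = 0)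
    (h10 : h (v 1) (v 0) ≠ 0) (h20 : h (v 2) (v 0) ≠ 0)
    (e10 : h (v 1) (v 0) = h (v' 1) (v' 0)) (e20 : h (v 2) (v 0) = h (v' 2) (v' 0))
    (e21 : h (v 2) (v 1) = h (v' 2) (v' 1)) :
    ∃ s, PreservesForm h s ∧ ∀ i, s (v i) = v' i := by
  have e01 : h (v 0) (v 1) = h (v' 0) (v' 1) := by rw [← hh.1 (v 1), e10, hh.1]
  have e02 : h (v 0) (v 2) = h (v' 0) (v' 2) := by rw [← hh.1 (v 2), e20, hh.1]
  have h01 : h (v 0) (v 1) ≠ 0 := mt hh.apply_eq_zero_comm.mp h10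
  have h02 : h (v 0) (v 2) ≠ 0 := mt hh.apply_eq_zero_comm.mp h20
  obtain ⟨s, hs, hs0⟩ : ∃ s, PreservesForm h s ∧ s (v 0) = v' 0 := by
    by_cases hne : h (v' 0) (v 0) = 0
    · -- the lines of `v 0` and `v' 0` are equal: pass through that of `v 1`
      have hv0 : v 0 ≠ 0 := fun h0 => by simp [h0] at h01
      obtain ⟨c, hc⟩ := hh.exists_eq_smul hv0 (hv 0) (hv' 0) (hh.apply_eq_zero_comm.mp hne)
      have hc0 : c ≠ 0 := by
        rintro rfl
        rw [zero_smul] at hc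
        exact h01 (by rw [e01, hc]; simp)
      obtain ⟨s, hs, hs0, -⟩ := hh.exists_reflection (hv 0) (hv 1) h10
      obtain ⟨t, ht, ht0, -⟩ := hh.exists_reflection (v := v 1) (v' := v' 0) (hv 1) (hv' 0)
        (by rw [hc]; simpa [hc0] using h01)
      exact ⟨t ∘ₗ s, ht.comp hs, by simp [hs0, ht0]⟩
    · obtain ⟨s, hs, hs0, -⟩ := hh.exists_reflection (hv 0) (hv' 0) hne
      exact ⟨s, hs, hs0⟩
  obtain ⟨t, ht, ht1, htf⟩ := hh.exists_preservesForm_fixing (a := s (v 1)) (a' := v' 1)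
    (w := v' 0) (by rw [hs, hv]) (hv' 1) (by rw [← hs0, hs, e01, hs0])
    (by rw [← hs0, hs]; exact h01)
  have ht0 : t (v' 0) = v' 0 := htf _ (by rw [← e10, ← hs0, hs])
  obtain ⟨r, hr, hr2, hrf⟩ := hh.exists_preservesForm_fixing (a := t (s (v 2))) (a' := v' 2)
    (w := v' 0) (by rw [ht, hs, hv]) (hv' 2) (by rw [← ht0, ← hs0, ht, hs, e02, hs0, ht0])
    (by rw [← ht0, ← hs0, ht, hs]; exact h02)
  refine ⟨r ∘ₗ t ∘ₗ s, hr.comp (ht.comp hs), fun i => ?_⟩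
  fin_cases i
  · simp only [Fin.zero_eta, LinearMap.comp_apply, hs0, ht0]
    exact hrf _ (by rw [← e20, ← ht0, ← hs0, ht, hs])
  · simp only [Fin.mk_one, LinearMap.comp_apply, ht1]
    exact hrf _ (by rw [← e21, ← ht1, ht, hs])
  · exact hr2

/-- The hyperbolic transformation with eigenvalues `2` and `1 / 2` on two isotropic lines. -/
theorem exists_boost (hh : HasSignature h p 1) {v z : Fin n → ℂ} (hv : h v v = 0)
    (hz : h z z = 0) (hvz : h v z = 1) :
    ∃ f, PreservesForm h f ∧ f v = (2 : ℂ) • v ∧ f z = (2⁻¹ : ℂ) • z := by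
  have hzv : h z v = 1 := by rw [← hh.1, hvz, map_one]
  obtain ⟨s, hs, hs1, -, hs2⟩ := hh.exists_reflection hv hz (by simp [hzv])
  obtain ⟨t, ht, ht1, -, ht2⟩ := hh.exists_reflection (v := z) (v' := (2 : ℂ) • v) hz
    (by simp [hv]) (by simp [hvz])
  have ht3 := ht2 (by simp [hvz, hzv, Complex.conj_ofNat])
  refine ⟨t ∘ₗ s, ht.comp hs, by simp [hs1, ht1], ?_⟩
  rw [LinearMap.comp_apply, hs2 (by rw [hvz, hzv]), ← ht3, map_smul, smul_smul]
  norm_num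

theorem norm_det_eq_one (hh : HasSignature h p 1) {f : (Fin n → ℂ) →ₗ[ℂ] (Fin n → ℂ)}
    (hf : PreservesForm h f) : ‖LinearMap.det f‖ = 1 := by
  obtain ⟨-, b, hb⟩ := hh
  set A := LinearMap.toMatrix b b f with hA
  set J : Matrix (Fin p ⊕ Fin 1) (Fin p ⊕ Fin 1) ℂ :=
    Matrix.diagonal (Sum.elim (fun _ => 1) (fun _ => -1)) with hJ
  have key : Aᴴ * J * A = J := by
    ext i j
    have h1 : ∀ k, f (b k) = ∑ l, A l k • b l := fun k => by
      conv_lhs => rw [← b.sum_repr (f (b k))]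
      simp only [hA, LinearMap.toMatrix_apply]
    have h2 := hf (b i) (b j)
    rw [hb, h1, h1] at h2
    rw [hJ, Matrix.diagonal_apply, ← h2, Matrix.mul_apply]
    simp only [map_sum, LinearMap.sum_apply, map_smulₛₗ, LinearMap.smul_apply, hb,
      smul_eq_mul, mul_ite, mul_zero, Matrix.mul_diagonal, Matrix.conjTranspose_apply,
      RingHom.id_apply]
    simp [mul_comm, mul_left_comm]
  have hJ0 : J.det ≠ 0 := by
    rw [hJ, Matrix.det_diagonal, Finset.prod_ne_zero_iff]
    rintro (i | i) - <;> simp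
  have h3 := congrArg Matrix.det key
  rw [Matrix.det_mul, Matrix.det_mul, Matrix.det_conjTranspose, hA, LinearMap.det_toMatrix] at h3
  have h4 : star (LinearMap.det f) * LinearMap.det f = 1 :=
    mul_right_cancel₀ hJ0 (by rw [one_mul]; linear_combination h3)
  rw [Complex.star_def, Complex.conj_mul'] at h4
  have h5 : ‖LinearMap.det f‖ ^ 2 = 1 := by exact_mod_cast h4
  exact (pow_eq_one_iff_of_nonneg (norm_nonneg _) two_ne_zero).mp h5

/-- Up to a unit scalar, an isometry has determinant `1`. -/
theorem exists_mem_specialUnitary (hh : HasSignature h p 1) (hn : n ≠ 0)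
    {f : (Fin n → ℂ) →ₗ[ℂ] (Fin n → ℂ)} (hf : PreservesForm h f) :
    ∃ g ∈ specialUnitary h, ∃ ζ : ℂ, ζ * starRingEnd ℂ ζ = 1 ∧ ∀ x, g • x = ζ • f x := by
  have hd := hh.norm_det_eq_one hf
  obtain ⟨ζ, hζ⟩ := IsAlgClosed.exists_pow_nat_eq (LinearMap.det f)⁻¹ (Nat.pos_of_ne_zero hn)
  have hζn : ‖ζ‖ = 1 := by
    have h1 := congrArg norm hζ
    rw [norm_pow, norm_inv, hd, inv_one] at h1
    exact (pow_eq_one_iff_of_nonneg (norm_nonneg _) hn).mp h1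
  have hζ1 : ζ * starRingEnd ℂ ζ = 1 := by rw [Complex.mul_conj', hζn]; norm_num
  have hdet : (LinearMap.toMatrix' (ζ • f)).det = 1 := by
    rw [LinearMap.det_toMatrix', LinearMap.det_smul, Module.finrank_fin_fun, hζ,
      inv_mul_cancel₀ (norm_ne_zero_iff.mp (by simp [hd]))]
  let g : Matrix.SpecialLinearGroup (Fin n) ℂ := ⟨_, hdet⟩
  have hg : ∀ x, g • x = ζ • f x := fun x => by
    rw [Matrix.SpecialLinearGroup.smul_def]
    exact LinearMap.toMatrix'_mulVec _ _
  refine ⟨g, fun x y => ?_, ζ, hζ1, hg⟩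
  rw [hg, hg]
  simp only [map_smulₛₗ, LinearMap.smul_apply, hf x y, smul_eq_mul, RingHom.id_apply]
  linear_combination h x y * hζ1

end HasSignature

/-! ### Semi-stability of triples of isotropic vectors -/

theorem IsMultihomogeneous.eval_smul {n r d : ℕ}
    {P : MvPolynomial ((Fin r × Fin n) ⊕ (Fin r × Fin n)) ℂ} (hP : IsMultihomogeneous d P)
    (a b : Fin r → ℂ) (v φ : Fin r → Fin n → ℂ) :
    MvPolynomial.eval (flagCoord (fun i => a i • v i) (fun i => b i • φ i)) P
      = (∏ i, a i * b i) ^ d * MvPolynomial.eval (flagCoord v φ) P := by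
  rw [MvPolynomial.eval_eq', MvPolynomial.eval_eq', Finset.mul_sum]
  refine Finset.sum_congr rfl fun m hm => ?_
  have h1 : ∀ i, ∏ j, a i ^ m (Sum.inl (i, j)) = a i ^ d := fun i => by
    rw [Finset.prod_pow_eq_pow_sum, (hP m hm i).1]
  have h2 : ∀ i, ∏ j, b i ^ m (Sum.inr (i, j)) = b i ^ d := fun i => by
    rw [Finset.prod_pow_eq_pow_sum, (hP m hm i).2]
  simp only [Fintype.prod_sum_type, Fintype.prod_prod_type, flagCoord, Sum.elim_inl, Sum.elim_inr,
    Pi.smul_apply, smul_eq_mul, mul_pow, Finset.prod_mul_distrib, h1, h2, Finset.prod_pow]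
  ring

theorem orthCovector_const_smul {n : ℕ} (h : SesqForm n) (c : ℂ) (v : Fin n → ℂ) :
    orthCovector h (c • v) = starRingEnd ℂ c • orthCovector h v := by
  funext j
  simp [orthCovector]

/-- Invariant sections take the same value at the images of isotropic vectors under an isometry,
whatever its determinant. -/
theorem IsInvariantSection.eval_preservesForm {n p r d : ℕ} {h : SesqForm n}
    (hh : HasSignature h p 1) (hn : n ≠ 0)
    {P : MvPolynomial ((Fin r × Fin n) ⊕ (Fin r × Fin n)) ℂ} (hP : IsInvariantSection d P)
    {f : (Fin n → ℂ) →ₗ[ℂ] (Fin n → ℂ)} (hf : PreservesForm h f) {v : Fin r → Fin n → ℂ}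
    (hv : ∀ i, h (v i) (v i) = 0) :
    MvPolynomial.eval (flagCoord (fun i => f (v i)) (fun i => orthCovector h (f (v i)))) P
      = MvPolynomial.eval (flagCoord v (fun i => orthCovector h (v i))) P := by
  obtain ⟨g, hg, ζ, hζ, hgf⟩ := hh.exists_mem_specialUnitary hn hf
  have h1 := hP.2 g v (fun i => orthCovector h (v i))
    (fun i => by rw [orthCovector_dotProduct]; exact hv i)
  simp only [← orthCovector_smul h hg, hgf, orthCovector_const_smul] at h1
  have h2 := hP.1.eval_smul (fun _ => ζ) (fun _ => starRingEnd ℂ ζ) (fun i => f (v i))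
    (fun i => orthCovector h (f (v i)))
  rw [← h1, h2]
  simp [hζ]

/-- A semi-stable triple has no two orthogonal lines: otherwise these two lines are equal, and
a hyperbolic transformation multiplies every invariant section by a constant different from `1`. -/
theorem HasSignature.apply_ne_zero_of_isSemistable {n p : ℕ} {h : SesqForm n}
    (hh : HasSignature h p 1) (hp : 2 ≤ p) (hn : n ≠ 0) {v : Fin 3 → Fin n → ℂ}
    (hv0 : ∀ i, v i ≠ 0) (hv : ∀ i, h (v i) (v i) = 0)
    (hs : IsSemistable v (fun i => orthCovector h (v i))) {i j : Fin 3} (hij : i ≠ j) :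
    h (v i) (v j) ≠ 0 := by
  intro hvij
  obtain ⟨d, hd, P, hP, hne⟩ := hs
  obtain ⟨c, hc⟩ := hh.exists_eq_smul (hv0 i) (hv i) (hv j) hvij
  obtain ⟨k, hk⟩ : ∃ k, ∀ l, l = k ∨ l = i ∨ l = j := by
    revert hij; clear * -; revert i j; decide
  -- `v k` spans the line of `v i` or that of some isotropic `z` with `h (v i) z = 1`
  obtain ⟨z, hz, hiz, e, hkz⟩ : ∃ z, h z z = 0 ∧ h (v i) z = 1 ∧
      ∃ e : ℂ, v k = e • v i ∨ v k = e • z := by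
    by_cases hik : h (v i) (v k) = 0
    · obtain ⟨e, he⟩ := hh.exists_eq_smul (hv0 i) (hv i) (hv k) hik
      obtain ⟨z, hz, hiz⟩ : ∃ z, h z z = 0 ∧ h (v i) z ≠ 0 := by
        by_contra! hcon
        obtain ⟨e₁, e₂, -, h11, h22, h12, -⟩ := hh.exists_isotropic_pair hp
        obtain ⟨c₁, rfl⟩ := hh.exists_eq_smul (hv0 i) (hv i) h11 (hcon e₁ h11)
        have h3 := hcon e₂ h22
        simp [h3] at h12
      exact ⟨(h (v i) z)⁻¹ • z, by simp [hz], by simp [hiz], e, Or.inl he⟩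
    · exact ⟨(h (v i) (v k))⁻¹ • v k, by simp [hv], by simp [hik], h (v i) (v k),
        Or.inr (by rw [smul_smul, mul_inv_cancel₀ hik, one_smul])⟩
  obtain ⟨f, hf, hf1, hf2⟩ := hh.exists_boost (hv i) hz hiz
  obtain ⟨α, hα, hfk⟩ : ∃ α : ℝ, (α = 2 ∨ α = 2⁻¹) ∧ f (v k) = (α : ℂ) • v k := by
    rcases hkz with h1 | h1
    · refine ⟨2, Or.inl rfl, ?_⟩
      rw [h1, map_smul, hf1, smul_comm]
      norm_num
    · refine ⟨2⁻¹, Or.inr rfl, ?_⟩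
      rw [h1, map_smul, hf2, smul_comm]
      norm_num
  set a : Fin 3 → ℂ := fun l => ((if l = k then α else 2 : ℝ) : ℂ) with ha
  have hfa : ∀ l, f (v l) = a l • v l := fun l => by
    by_cases hlk : l = k
    · subst hlk
      simpa [ha] using hfk
    · have h1 : f (v l) = (2 : ℂ) • v l := by
        rcases hk l with h1 | rfl | rfl
        · exact absurd h1 hlk
        · exact hf1
        · rw [hc, map_smul, hf1, smul_comm]
      simpa [ha, hlk] using h1
  have h1 := hP.eval_preservesForm hh hn hf hv
  have h2 := hP.1.eval_smul a (fun l => starRingEnd ℂ (a l)) v (fun l => orthCovector h (v l))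
  simp only [hfa, orthCovector_const_smul] at h1
  have h3 : (∏ l, a l * starRingEnd ℂ (a l)) ^ d = 1 :=
    mul_right_cancel₀ hne (by rw [← h2, h1, one_mul])
  have h4 : (∏ l, a l * starRingEnd ℂ (a l)) = ((16 * α ^ 2 : ℝ) : ℂ) := by
    simp only [ha, Complex.conj_ofReal, Fin.prod_univ_three]
    clear * -
    fin_cases k <;> · simp; ring
  rw [h4] at h3
  have h5 : (16 * α ^ 2) ^ d = 1 := by exact_mod_cast h3
  have h6 := (pow_eq_one_iff_of_nonneg (by positivity) (by lia)).mp h5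
  rcases hα with rfl | rfl <;> norm_num at h6

/-- The invariant `h(v₁, v₃) h(v₃, v₂) h(v₂, v₁)` of three vectors, whose argument is the angular
invariant of Cartan if they are isotropic. -/
def tripleProduct {n : ℕ} (h : SesqForm n) (v : Fin 3 → Fin n → ℂ) : ℂ :=
  h (v 0) (v 2) * h (v 2) (v 1) * h (v 1) (v 0)

/-- The polynomial `φ i ⬝ᵥ v j` in the coordinates of an `r`-tuple of flags. -/
noncomputable def pairingPoly (n : ℕ) {r : ℕ} (i j : Fin r) :
    MvPolynomial ((Fin r × Fin n) ⊕ (Fin r × Fin n)) ℂ :=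
  ∑ k, MvPolynomial.X (Sum.inr (i, k)) * MvPolynomial.X (Sum.inl (j, k))

theorem eval_pairingPoly {n r : ℕ} (v φ : Fin r → Fin n → ℂ) (i j : Fin r) :
    MvPolynomial.eval (flagCoord v φ) (pairingPoly n i j) = φ i ⬝ᵥ v j := by
  simp [pairingPoly, flagCoord, dotProduct]

theorem isWeightedHomogeneous_pairingPoly {n r : ℕ} (α β : Fin r → ℕ) (i j : Fin r) :
    (pairingPoly n i j).IsWeightedHomogeneous
      (Sum.elim (fun k => α k.1) (fun k => β k.1)) (β i + α j) :=
  MvPolynomial.IsWeightedHomogeneous.sum _ _ _ fun _ _ =>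
    (MvPolynomial.isWeightedHomogeneous_X ℂ _ _).mul (MvPolynomial.isWeightedHomogeneous_X ℂ _ _)

theorem isInvariantSection_pairingPoly_mul (n : ℕ) :
    IsInvariantSection 1
      (pairingPoly n (0 : Fin 3) 2 * pairingPoly n 2 1 * pairingPoly n 1 0) := by
  refine ⟨fun m hm i => ?_, fun g v φ _ => ?_⟩
  · have key : ∀ α β : Fin 3 → ℕ, ∑ l, (∑ k, m (Sum.inl (l, k))) * α l +
        ∑ l, (∑ k, m (Sum.inr (l, k))) * β l = β 0 + α 2 + (β 2 + α 1) + (β 1 + α 0) :=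
      fun α β => by
        have h1 := (((isWeightedHomogeneous_pairingPoly (n := n) α β 0 2).mul
          (isWeightedHomogeneous_pairingPoly α β 2 1)).mul
          (isWeightedHomogeneous_pairingPoly α β 1 0)) (MvPolynomial.mem_support_iff.mp hm)
        rw [Finsupp.weight_apply, Finsupp.sum_fintype _ _ (by simp)] at h1
        simpa only [Fintype.sum_sum_type, Fintype.sum_prod_type, Sum.elim_inl, Sum.elim_inr,
          smul_eq_mul, ← Finset.sum_mul] using h1
    have h1 := key (Pi.single i 1) 0
    have h2 := key 0 (Pi.single i 1)
    simp only [Pi.zero_apply, mul_zero, Finset.sum_const_zero, Pi.single_apply, mul_ite, mul_one,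
      Finset.sum_ite_eq', Finset.mem_univ, if_true, add_zero, zero_add] at h1 h2
    rw [h1, h2]
    clear * -
    revert i
    decide
  · have key : ∀ i j, (φ i ᵥ* (↑g⁻¹ : Matrix (Fin n) (Fin n) ℂ)) ⬝ᵥ (g • v j) = φ i ⬝ᵥ v j :=
      fun i j => by
        rw [← Matrix.dotProduct_mulVec]
        exact congrArg (φ i ⬝ᵥ ·) (inv_smul_smul g (v j))
    simp only [map_mul, eval_pairingPoly, key]

theorem isSemistable_of_tripleProduct_ne_zero {n : ℕ} (h : SesqForm n) {v : Fin 3 → Fin n → ℂ}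
    (hv : tripleProduct h v ≠ 0) : IsSemistable v (fun i => orthCovector h (v i)) := by
  refine ⟨1, le_rfl, _, isInvariantSection_pairingPoly_mul n, ?_⟩
  simpa only [tripleProduct, map_mul, eval_pairingPoly, orthCovector_dotProduct] using hv

/-! ### The angular invariant of Cartan -/

theorem tripleProduct_smul {n : ℕ} (h : SesqForm n) (c : Fin 3 → ℂ) (v : Fin 3 → Fin n → ℂ) :
    tripleProduct h (fun i => c i • v i)
      = ((∏ i, ‖c i‖ ^ 2 : ℝ) : ℂ) * tripleProduct h v := by
  simp only [tripleProduct, map_smulₛₗ, LinearMap.smul_apply, smul_eq_mul, Fin.prod_univ_three,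
    Complex.ofReal_mul, Complex.ofReal_pow, ← Complex.conj_mul', RingHom.id_apply]
  ring

theorem Complex.ofReal_mul_div_norm {r : ℝ} (hr : 0 < r) (z : ℂ) :
    (r : ℂ) * z / (‖(r : ℂ) * z‖ : ℂ) = z / (‖z‖ : ℂ) := by
  rw [norm_mul, Complex.norm_real, Real.norm_of_nonneg hr.le, Complex.ofReal_mul,
    mul_div_mul_left _ _ (Complex.ofReal_ne_zero.mpr hr.ne')]

namespace HasSignature

variable {n p : ℕ} {h : SesqForm n}

/-- The Gram matrix of three isotropic vectors has determinant `2 Re (tripleProduct h v)`. The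
inequality is the positivity of `h` at the projection of `v 2` to the orthogonal of `v 0` and
`v 1`. -/
theorem re_tripleProduct_nonpos (hh : HasSignature h p 1) {v : Fin 3 → Fin n → ℂ}
    (hv : ∀ i, h (v i) (v i) = 0) (hne : tripleProduct h v ≠ 0) :
    (tripleProduct h v).re ≤ 0 := by
  have h10 : h (v 1) (v 0) ≠ 0 := right_ne_zero_of_mul hne
  have h01 : h (v 0) (v 1) ≠ 0 := mt hh.apply_eq_zero_comm.mp h10
  have e10 := hh.1 (v 0) (v 1)
  have e01 := hh.1 (v 1) (v 0)
  have e20 := hh.1 (v 0) (v 2)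
  set w := v 2 - (h (v 1) (v 2) / h (v 1) (v 0)) • v 0 - (h (v 0) (v 2) / h (v 0) (v 1)) • v 1
    with hw
  have h0w : h (v 0) w = 0 := by
    simp [hw, hv, h01]
  have h1w : h (v 1) w = 0 := by
    simp [hw, hv, h10]
  have h2w : h (v 2) w = -(h (v 1) (v 2) / h (v 1) (v 0) * h (v 2) (v 0)
      + h (v 0) (v 2) / h (v 0) (v 1) * h (v 2) (v 1)) := by
    simp only [hw, map_sub, map_smul, hv, smul_eq_mul]
    ring
  have hww : h w w = h (v 2) w := by
    have h3 : ∀ y, h (v 0) y = 0 → h (v 1) y = 0 → h w y = h (v 2) y := fun y h0 h1 => by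
      simp [hw, h0, h1]
    exact h3 w h0w h1w
  have hpos := hh.re_apply_self_nonneg (v := v 0) (fun h0 => h01 (by simp [h0])) (hv 0) h0w
  have key : ((‖h (v 0) (v 1)‖ ^ 2 : ℝ) : ℂ) * h w w
      = ((-2 * (tripleProduct h v).re : ℝ) : ℂ) := by
    have h2re : ((-2 * (tripleProduct h v).re : ℝ) : ℂ)
        = -(tripleProduct h v + starRingEnd ℂ (tripleProduct h v)) := by
      rw [Complex.add_conj]
      push_cast
      ring
    rw [h2re, hww, h2w, Complex.ofReal_pow, ← Complex.conj_mul', e10, tripleProduct]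
    simp only [map_mul, e20, e01, hh.1 (v 2) (v 1)]
    field_simp
    ring
  have h3 := congrArg Complex.re key
  rw [Complex.re_ofReal_mul, Complex.ofReal_re] at h3
  nlinarith [mul_nonneg (sq_nonneg ‖h (v 0) (v 1)‖) hpos]

/-- The angular invariant separates the orbits: after rescaling, the two triples have the same Gram
matrix. -/
theorem exists_smul_eq_of_tripleProduct (hh : HasSignature h p 1) (hn : n ≠ 0)
    {v v' : Fin 3 → Fin n → ℂ} (hv : ∀ i, h (v i) (v i) = 0) (hv' : ∀ i, h (v' i) (v' i) = 0)
    (hne : tripleProduct h v ≠ 0) (hne' : tripleProduct h v' ≠ 0)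
    (heq : tripleProduct h v / (‖tripleProduct h v‖ : ℂ)
      = tripleProduct h v' / (‖tripleProduct h v'‖ : ℂ)) :
    ∃ g ∈ specialUnitary h, ∃ c : Fin 3 → ℂ, ∀ i, g • v i = c i • v' i := by
  have h10 : h (v 1) (v 0) ≠ 0 := right_ne_zero_of_mul hne
  have h21 : h (v 2) (v 1) ≠ 0 := right_ne_zero_of_mul (left_ne_zero_of_mul hne)
  have h02 : h (v 0) (v 2) ≠ 0 := left_ne_zero_of_mul (left_ne_zero_of_mul hne)
  have h10' : h (v' 1) (v' 0) ≠ 0 := right_ne_zero_of_mul hne'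
  have h21' : h (v' 2) (v' 1) ≠ 0 := right_ne_zero_of_mul (left_ne_zero_of_mul hne')
  have h02' : h (v' 0) (v' 2) ≠ 0 := left_ne_zero_of_mul (left_ne_zero_of_mul hne')
  have h20 : h (v 2) (v 0) ≠ 0 := mt hh.apply_eq_zero_comm.mp h02
  have h20' : h (v' 2) (v' 0) ≠ 0 := mt hh.apply_eq_zero_comm.mp h02'
  -- If `v' 0` is multiplied by a real `s`, the products with `v' 0` determine the factors of `v' 1`
  -- and `v' 2`; the product of the last two vectors is then right for exactly one value of `s ^ 2`,
  -- which is positive because the arguments of the triple products agree.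
  obtain ⟨s, hs0, hs⟩ : ∃ s : ℝ, s ≠ 0 ∧ ((s ^ 2 : ℝ) : ℂ) * tripleProduct h v' *
      (h (v 1) (v 2) * h (v 2) (v 1))
      = tripleProduct h v * (h (v' 1) (v' 2) * h (v' 2) (v' 1)) := by
    set A := ‖tripleProduct h v‖ / ‖tripleProduct h v'‖ * ‖h (v' 2) (v' 1)‖ ^ 2
      / ‖h (v 2) (v 1)‖ ^ 2 with hA
    have hApos : 0 < A := by positivity
    refine ⟨√A, (Real.sqrt_pos.mpr hApos).ne', ?_⟩
    rw [Real.sq_sqrt hApos.le, ← hh.1 (v 2) (v 1), ← hh.1 (v' 2) (v' 1), Complex.conj_mul',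
      Complex.conj_mul', hA]
    have hN : (‖tripleProduct h v‖ : ℂ) ≠ 0 := by simpa using hne
    have hN' : (‖tripleProduct h v'‖ : ℂ) ≠ 0 := by simpa using hne'
    have hN21 : (‖h (v 2) (v 1)‖ : ℂ) ≠ 0 := by simpa using h21
    rw [div_eq_div_iff hN hN'] at heq
    push_cast
    field_simp
    linear_combination -(‖h (v' 2) (v' 1)‖ : ℂ) ^ 2 * heq
  have hs0' : (s : ℂ) ≠ 0 := Complex.ofReal_ne_zero.mpr hs0
  set c : Fin 3 → ℂ := ![s, starRingEnd ℂ (h (v 1) (v 0) / (s * h (v' 1) (v' 0))),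
    starRingEnd ℂ (h (v 2) (v 0) / (s * h (v' 2) (v' 0)))] with hc
  obtain ⟨f, hf, hfv⟩ := hh.exists_preservesForm_triple (v' := fun i => c i • v' i) hv
    (fun i => by simp [hv']) h10 h20 (by simp [hc]; field_simp) (by simp [hc]; field_simp) (by
      have h3 : (s : ℂ) ^ 2 * (h (v' 0) (v' 2) * h (v' 1) (v' 0)) * h (v 1) (v 2)
          = h (v 0) (v 2) * h (v 1) (v 0) * h (v' 1) (v' 2) :=
        mul_right_cancel₀ (mul_ne_zero h21 h21') (by
          simp only [tripleProduct, Complex.ofReal_pow] at hs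
          linear_combination hs)
      have h4 := congrArg (starRingEnd ℂ) h3
      simp only [map_mul, map_pow, Complex.conj_ofReal, hh.1] at h4
      have h01' : h (v' 0) (v' 1) ≠ 0 := mt hh.apply_eq_zero_comm.mp h10'
      simp [hc, hh.1]
      field_simp
      linear_combination h4)
  obtain ⟨g, hg, ζ, -, hgf⟩ := hh.exists_mem_specialUnitary hn hf
  exact ⟨g, hg, fun i => ζ * c i, fun i => by rw [hgf, hfv, smul_smul]⟩

/-- Isotropic triples realizing every angular invariant in the half-circle. -/
theorem exists_tripleProduct_eq (hh : HasSignature h p 1) (hp : 2 ≤ p) :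
    ∃ v : ℂ → Fin 3 → Fin n → ℂ, Continuous v ∧ ∀ u : ℂ, u.re ≤ 0 →
      (∀ i, h (v u i) (v u i) = 0) ∧ tripleProduct h (v u) = u := by
  obtain ⟨e₁, e₂, e₃, h11, h22, h12, h33, h13, h23⟩ := hh.exists_isotropic_pair hp
  have h21 : h e₂ e₁ = 1 := by rw [← hh.1, h12, map_one]
  have h31 := hh.apply_eq_zero_comm.mp h13
  have h32 := hh.apply_eq_zero_comm.mp h23
  obtain ⟨R, hRc, hR⟩ : ∃ R : ℂ → ℂ, Continuous R ∧
      ∀ u : ℂ, u.re ≤ 0 → starRingEnd ℂ (R u) * R u = -(u + starRingEnd ℂ u) := by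
    refine ⟨fun u => ((√(-2 * u.re) : ℝ) : ℂ), by fun_prop, fun u hu => ?_⟩
    rw [Complex.conj_ofReal, ← Complex.ofReal_mul, Real.mul_self_sqrt (by linarith),
      Complex.add_conj]
    push_cast
    ring
  refine ⟨fun u => ![e₁, e₂, e₁ + u • e₂ + R u • e₃], ?_, fun u hu => ⟨?_, ?_⟩⟩
  · refine continuous_pi fun i => ?_
    fin_cases i
    · exact continuous_const
    · exact continuous_const
    · simp only [Fin.reduceFinMk, Matrix.cons_val]
      fun_prop
  · intro i
    fin_cases i
    · exact h11
    · exact h22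
    · simp [h11, h22, h12, h33, h13, h23, h21, h31, h32]
      linear_combination hR u hu
  · simp [tripleProduct, h11, h22, h12, h13, h21, h32]

end HasSignature

/-! ### The topology of the projective space -/

theorem isOpenQuotientMap_projectivizationMk (n : ℕ) :
    IsOpenQuotientMap (Projectivization.mk' (V := Fin n → ℂ) ℂ) where
  surjective := Quotient.mk_surjective
  continuous := continuous_coinduced_rng
  isOpenMap U hU := by
    rw [isOpen_coinduced]
    have h1 : Projectivization.mk' (V := Fin n → ℂ) ℂ ⁻¹' (Projectivization.mk' ℂ '' U)
        = ⋃ c : ℂˣ, (fun v : {v : Fin n → ℂ // v ≠ 0} =>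
          (⟨c • v.1, (smul_ne_zero_iff_ne c).mpr v.2⟩ : {v : Fin n → ℂ // v ≠ 0})) ⁻¹' U := by
      ext v
      simp only [Set.mem_preimage, Set.mem_image, Set.mem_iUnion]
      constructor
      · rintro ⟨w, hw, hwv⟩
        rw [Projectivization.mk'_eq_mk, Projectivization.mk'_eq_mk,
          Projectivization.mk_eq_mk_iff] at hwv
        obtain ⟨c, hc⟩ := hwv
        exact ⟨c, by simpa only [hc] using hw⟩
      · rintro ⟨c, hc⟩
        exact ⟨_, hc, (Projectivization.mk_eq_mk_iff ℂ _ _ _ _).mpr ⟨c, rfl⟩⟩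
    rw [h1]
    exact isOpen_iUnion fun c => hU.preimage (by fun_prop)

theorem eq_mk_of_mem_submodule {n : ℕ} {L : ℙ ℂ (Fin n → ℂ)} {v : Fin n → ℂ} (hv0 : v ≠ 0)
    (hv : v ∈ L.submodule) : L = Projectivization.mk ℂ v hv0 := by
  induction L with
  | h u hu =>
    rw [Projectivization.submodule_mk, Submodule.mem_span_singleton] at hv
    obtain ⟨c, hc⟩ := hv
    exact ((Projectivization.mk_eq_mk_iff' ℂ _ _ _ _).mpr ⟨c, hc⟩).symm

theorem isGenerators_mk {n r : ℕ} {v : Fin r → Fin n → ℂ} (hv : ∀ i, v i ≠ 0) :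
    IsGenerators v (fun i => Projectivization.mk ℂ (v i) (hv i)) :=
  fun i => ⟨hv i, by rw [Projectivization.submodule_mk]; exact Submodule.mem_span_singleton_self _⟩

theorem isGenerators_rep {n r : ℕ} (x : Fin r → ℙ ℂ (Fin n → ℂ)) :
    IsGenerators (fun i => (x i).rep) x :=
  fun i => ⟨(x i).rep_nonzero, by
    rw [Projectivization.submodule_eq]; exact Submodule.mem_span_singleton_self _⟩

theorem IsGenerators.exists_smul_eq {n r : ℕ} {v w : Fin r → Fin n → ℂ}
    {x : Fin r → ℙ ℂ (Fin n → ℂ)} (hv : IsGenerators v x) (hw : IsGenerators w x) :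
    ∃ c : Fin r → ℂ, (∀ i, c i ≠ 0) ∧ w = fun i => c i • v i := by
  have h1 : ∀ i, ∃ c : ℂ, c ≠ 0 ∧ w i = c • v i := fun i => by
    have h2 := (hw i).2
    rw [eq_mk_of_mem_submodule (hv i).1 (hv i).2, Projectivization.submodule_mk,
      Submodule.mem_span_singleton] at h2
    obtain ⟨c, hc⟩ := h2
    refine ⟨c, ?_, hc.symm⟩
    rintro rfl
    exact (hw i).1 (by rw [← hc, zero_smul])
  choose c hc0 hc using h1
  exact ⟨c, hc0, funext hc⟩

/-- The argument, in `U(1)`, of the product `h(v₁, v₃) h(v₃, v₂) h(v₂, v₁)` of generators of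
a triple of lines. It does not depend on the generators (`IsGenerators.angularInvariant_eq`), and is
`0` if the product vanishes. -/
noncomputable def angularInvariant {n : ℕ} (h : SesqForm n) (x : Fin 3 → ℙ ℂ (Fin n → ℂ)) : ℂ :=
  tripleProduct h (fun i => (x i).rep) / (‖tripleProduct h (fun i => (x i).rep)‖ : ℂ)

theorem IsGenerators.exists_tripleProduct_eq {n : ℕ} (h : SesqForm n) {v w : Fin 3 → Fin n → ℂ}
    {x : Fin 3 → ℙ ℂ (Fin n → ℂ)} (hv : IsGenerators v x) (hw : IsGenerators w x) :
    ∃ r : ℝ, 0 < r ∧ tripleProduct h w = r * tripleProduct h v := by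
  obtain ⟨c, hc0, rfl⟩ := hv.exists_smul_eq hw
  exact ⟨_, Finset.prod_pos fun i _ => by have := hc0 i; positivity, tripleProduct_smul h c v⟩

theorem IsGenerators.angularInvariant_eq {n : ℕ} (h : SesqForm n) {v : Fin 3 → Fin n → ℂ}
    {x : Fin 3 → ℙ ℂ (Fin n → ℂ)} (hv : IsGenerators v x) :
    angularInvariant h x = tripleProduct h v / (‖tripleProduct h v‖ : ℂ) := by
  obtain ⟨r, hr, hrv⟩ := hv.exists_tripleProduct_eq h (isGenerators_rep x)
  rw [angularInvariant, hrv, Complex.ofReal_mul_div_norm hr]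

theorem SesqForm.continuous_apply {n : ℕ} (h : SesqForm n) :
    Continuous fun x : (Fin n → ℂ) × (Fin n → ℂ) => h x.1 x.2 := by
  have h1 : ∀ x : (Fin n → ℂ) × (Fin n → ℂ), h x.1 x.2
      = ∑ i, starRingEnd ℂ (x.1 i) * h (Pi.single i 1) x.2 := fun x => by
    conv_lhs => rw [pi_eq_sum_univ' x.1]
    simp [map_sum, LinearMap.sum_apply]
  simp only [h1]
  refine continuous_finsetSum _ fun i _ => ?_
  have h2 := (h (Pi.single i 1)).continuous_of_finiteDimensional
  fun_prop

theorem continuous_tripleProduct {n : ℕ} (h : SesqForm n) : Continuous (tripleProduct h) := by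
  have h1 : ∀ i j : Fin 3, Continuous fun v : Fin 3 → Fin n → ℂ => h (v i) (v j) := fun i j =>
    h.continuous_apply.comp (f := fun v : Fin 3 → Fin n → ℂ => (v i, v j)) (by fun_prop)
  exact ((h1 0 2).mul (h1 2 1)).mul (h1 1 0)

theorem continuousAt_angularInvariant {n : ℕ} (h : SesqForm n) {v : Fin 3 → Fin n → ℂ}
    {x : Fin 3 → ℙ ℂ (Fin n → ℂ)} (hv : IsGenerators v x) (hne : tripleProduct h v ≠ 0) :
    ContinuousAt (angularInvariant h) x := by
  have hq := IsOpenQuotientMap.piMap fun _ : Fin 3 => isOpenQuotientMap_projectivizationMk n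
  set w : Fin 3 → {v : Fin n → ℂ // v ≠ 0} := fun i => ⟨v i, (hv i).1⟩ with hw
  have hx : x = Pi.map (fun _ => Projectivization.mk' (V := Fin n → ℂ) ℂ) w :=
    funext fun i => eq_mk_of_mem_submodule (hv i).1 (hv i).2
  rw [hx, ← hq.continuousAt_comp_iff]
  have h1 : angularInvariant h ∘ Pi.map (fun _ => Projectivization.mk' (V := Fin n → ℂ) ℂ)
      = fun w : Fin 3 → {v : Fin n → ℂ // v ≠ 0} => tripleProduct h (fun i => (w i).1) /
        (‖tripleProduct h (fun i => (w i).1)‖ : ℂ) :=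
    funext fun w => (isGenerators_mk fun i => (w i).2).angularInvariant_eq h
  rw [h1]
  have h2 : Continuous fun w : Fin 3 → {v : Fin n → ℂ // v ≠ 0} =>
      tripleProduct h (fun i => (w i).1) := (continuous_tripleProduct h).comp (by fun_prop)
  exact h2.continuousAt.div (Complex.continuous_ofReal.comp h2.norm).continuousAt
    (by simpa using hne)

/-! ### The separated quotient of the space of semi-stable triples -/

namespace HasSignature

variable {n p : ℕ} {h : SesqForm n}

theorem tripleProduct_ne_zero (hh : HasSignature h p 1) (hp : 2 ≤ p) (hn : n ≠ 0)
    (x : semistableIsotropic h 3) {v : Fin 3 → Fin n → ℂ} (hv : IsGenerators v x.1) :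
    tripleProduct h v ≠ 0 := by
  obtain ⟨x, hx, w, hw, hs⟩ := x
  obtain ⟨r, hr, hrv⟩ := hw.exists_tripleProduct_eq h hv
  have hij : ∀ {i j : Fin 3}, i ≠ j → h (w i) (w j) ≠ 0 :=
    hh.apply_ne_zero_of_isSemistable hp hn (fun i => (hw i).1) (fun i => hx i _ (hw i).2) hs
  rw [hrv]
  exact mul_ne_zero (Complex.ofReal_ne_zero.mpr hr.ne')
    (mul_ne_zero (mul_ne_zero (hij (by decide)) (hij (by decide))) (hij (by decide)))

theorem norm_angularInvariant (hh : HasSignature h p 1) (hp : 2 ≤ p) (hn : n ≠ 0)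
    (x : semistableIsotropic h 3) : ‖angularInvariant h x.1‖ = 1 := by
  have h1 := norm_ne_zero_iff.mpr (hh.tripleProduct_ne_zero hp hn x (isGenerators_rep x.1))
  rw [angularInvariant, norm_div, Complex.norm_real, norm_norm, div_self h1]

theorem re_angularInvariant_nonpos (hh : HasSignature h p 1) (hp : 2 ≤ p) (hn : n ≠ 0)
    (x : semistableIsotropic h 3) : (angularInvariant h x.1).re ≤ 0 := by
  rw [angularInvariant, Complex.div_ofReal_re]
  exact div_nonpos_of_nonpos_of_nonneg (hh.re_tripleProduct_nonpos
    (fun i => x.2.1 i _ (isGenerators_rep x.1 i).2)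
    (hh.tripleProduct_ne_zero hp hn x (isGenerators_rep x.1))) (norm_nonneg _)

theorem mem_orbit_iff (hh : HasSignature h p 1) (hp : 2 ≤ p) (hn : n ≠ 0)
    (x y : semistableIsotropic h 3) :
    y ∈ MulAction.orbit (specialUnitary h) x ↔ angularInvariant h y.1 = angularInvariant h x.1 := by
  constructor
  · rintro ⟨g, rfl⟩
    have h1 : IsGenerators (fun i => g • (x.1 i).rep) (g • x).1 := fun i =>
      ⟨(smul_ne_zero_iff_ne g.1).mpr (x.1 i).rep_nonzero,
        smul_mem_submodule_smul g.1 _ (isGenerators_rep x.1 i).2⟩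
    rw [h1.angularInvariant_eq, angularInvariant]
    have h2 : tripleProduct h (fun i => g • (x.1 i).rep) = tripleProduct h fun i => (x.1 i).rep :=
      congrArg₂ (· * ·) (congrArg₂ (· * ·) (g.2 _ _) (g.2 _ _)) (g.2 _ _)
    rw [h2]
  · intro hxy
    obtain ⟨g, hg, c, hgc⟩ := hh.exists_smul_eq_of_tripleProduct hn
      (fun i => x.2.1 i _ (isGenerators_rep x.1 i).2)
      (fun i => y.2.1 i _ (isGenerators_rep y.1 i).2)
      (hh.tripleProduct_ne_zero hp hn x (isGenerators_rep x.1))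
      (hh.tripleProduct_ne_zero hp hn y (isGenerators_rep y.1)) hxy.symm
    refine ⟨⟨g, hg⟩, Subtype.ext (funext fun i => ?_)⟩
    have h1 : (g • (x.1 i).rep) ∈ (y.1 i).submodule := by
      rw [hgc]
      exact Submodule.smul_mem _ _ (isGenerators_rep y.1 i).2
    have h2 : g • (x.1 i).rep ∈ (g • x.1 i).submodule :=
      smul_mem_submodule_smul g _ (isGenerators_rep x.1 i).2
    have h3 : g • (x.1 i).rep ≠ 0 := (smul_ne_zero_iff_ne g).mpr (x.1 i).rep_nonzero
    exact (eq_mk_of_mem_submodule h3 h2).trans (eq_mk_of_mem_submodule h3 h1).symm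

/-- The angular invariant as a map to the closed half-circle. -/
noncomputable def toHalfCircle (hh : HasSignature h p 1) (hp : 2 ≤ p) (hn : n ≠ 0)
    (x : semistableIsotropic h 3) : halfCircle :=
  ⟨⟨angularInvariant h x.1, mem_sphere_zero_iff_norm.mpr (hh.norm_angularInvariant hp hn x)⟩,
    hh.re_angularInvariant_nonpos hp hn x⟩

theorem continuous_toHalfCircle (hh : HasSignature h p 1) (hp : 2 ≤ p) (hn : n ≠ 0) :
    Continuous (hh.toHalfCircle hp hn) := by
  have h1 : Continuous fun x : semistableIsotropic h 3 => angularInvariant h x.1 :=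
    continuous_iff_continuousAt.mpr fun x =>
      (continuousAt_angularInvariant h (isGenerators_rep x.1)
        (hh.tripleProduct_ne_zero hp hn x (isGenerators_rep x.1))).comp
          continuous_subtype_val.continuousAt
  exact (h1.subtype_mk _).subtype_mk _

theorem exists_continuous_rightInverse_toHalfCircle (hh : HasSignature h p 1) (hp : 2 ≤ p)
    (hn : n ≠ 0) : ∃ σ : halfCircle → semistableIsotropic h 3, Continuous σ ∧
      ∀ u, hh.toHalfCircle hp hn (σ u) = u := by
  obtain ⟨v, hvc, hv⟩ := hh.exists_tripleProduct_eq hp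
  have hT : ∀ u : halfCircle, tripleProduct h (v (u : Circle)) = (u : Circle) :=
    fun u => (hv _ u.2).2
  have hne : ∀ u : halfCircle, tripleProduct h (v (u : Circle)) ≠ 0 :=
    fun u => by rw [hT]; exact Circle.coe_ne_zero _
  have hv0 : ∀ (u : halfCircle) i, v (u : Circle) i ≠ 0 := fun u i h0 => by
    refine hne u ?_
    fin_cases i <;> simp at h0 <;> simp [tripleProduct, h0]
  refine ⟨fun u => ⟨fun i => Projectivization.mk ℂ (v (u : Circle) i) (hv0 u i), fun i w hw => ?_,
    _, isGenerators_mk (hv0 u), isSemistable_of_tripleProduct_ne_zero h (hne u)⟩, ?_, fun u => ?_⟩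
  · rw [Projectivization.submodule_mk, Submodule.mem_span_singleton] at hw
    obtain ⟨c, rfl⟩ := hw
    simp [(hv _ u.2).1 i]
  · refine Continuous.subtype_mk (continuous_pi fun i => ?_) _
    have h1 : Continuous fun u : halfCircle =>
        (⟨v (u : Circle) i, hv0 u i⟩ : {v : Fin n → ℂ // v ≠ 0}) :=
      Continuous.subtype_mk ((continuous_apply i).comp (hvc.comp
        (continuous_induced_dom.comp continuous_subtype_val))) _
    exact (isOpenQuotientMap_projectivizationMk n).continuous.comp h1
  · refine Subtype.ext (Circle.ext ?_)
    refine ((isGenerators_mk (hv0 u)).angularInvariant_eq h).trans ?_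
    rw [hT, Circle.norm_coe, Complex.ofReal_one, div_one]

theorem isClosed_orbit (hh : HasSignature h p 1) (hp : 2 ≤ p) (hn : n ≠ 0)
    (x : semistableIsotropic h 3) : IsClosed (MulAction.orbit (specialUnitary h) x) := by
  have h1 : MulAction.orbit (specialUnitary h) x
      = hh.toHalfCircle hp hn ⁻¹' {hh.toHalfCircle hp hn x} := by
    ext y
    rw [hh.mem_orbit_iff hp hn, Set.mem_preimage, Set.mem_singleton_iff, Subtype.ext_iff,
      Circle.ext_iff]
    rfl
  rw [h1]
  exact isClosed_singleton.preimage (hh.continuous_toHalfCircle hp hn)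

end HasSignature

/-- The map sending a point to its orbit, if all orbits are closed. -/
def orbitMap {G X : Type*} [Group G] [MulAction G X] [TopologicalSpace X]
    (hcl : ∀ x : X, IsClosed (MulAction.orbit G x)) (x : X) : ClosedOrbit G X :=
  ⟨MulAction.orbit G x, hcl x, x, rfl⟩

section orbitMap

variable {G X : Type*} [Group G] [MulAction G X] [TopologicalSpace X]
  (hcl : ∀ x : X, IsClosed (MulAction.orbit G x))

theorem orbitMap_eq_iff {x y : X} : orbitMap hcl x = orbitMap hcl y ↔ x ∈ MulAction.orbit G y := by
  rw [← MulAction.orbit_eq_iff]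
  exact Subtype.ext_iff

theorem orbitMap_surjective : Function.Surjective (orbitMap hcl) := by
  rintro ⟨O, hO, x, rfl⟩
  exact ⟨x, rfl⟩

theorem isClosedOrbitProjection_orbitMap : IsClosedOrbitProjection (orbitMap hcl) := by
  intro x O
  obtain ⟨y, rfl⟩ := orbitMap_surjective hcl O
  rw [orbitMap_eq_iff, (hcl x).closure_eq]
  exact ⟨fun hyx => hyx (MulAction.mem_orbit_self y),
    fun hyx => (MulAction.orbit_eq_iff.mpr hyx).subset⟩

end orbitMap

theorem mainTheorem8 (n : ℕ) (hn : 3 ≤ n) (h : SesqForm n) (hh : HasSignature h (n - 1) 1) :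
    ∃ q : semistableIsotropic h 3 →
        ClosedOrbit (specialUnitary h) (semistableIsotropic h 3),
      IsClosedOrbitProjection q ∧
      letI : TopologicalSpace (ClosedOrbit (specialUnitary h) (semistableIsotropic h 3)) :=
        TopologicalSpace.coinduced q inferInstance
      ∃ e : ClosedOrbit (specialUnitary h) (semistableIsotropic h 3) ≃ₜ halfCircle,
        ∀ (x : semistableIsotropic h 3) (v : Fin 3 → Fin n → ℂ), IsGenerators v x.1 →
          h (v 0) (v 2) * h (v 2) (v 1) * h (v 1) (v 0) ≠ 0 ∧
          ((e (q x) : Circle) : ℂ) =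
            h (v 0) (v 2) * h (v 2) (v 1) * h (v 1) (v 0) /
              (‖h (v 0) (v 2) * h (v 2) (v 1) * h (v 1) (v 0)‖ : ℂ) := by
  have hp : 2 ≤ n - 1 := by lia
  have hn0 : n ≠ 0 := by lia
  have hcl := hh.isClosed_orbit hp hn0
  set q := orbitMap hcl with hq
  refine ⟨q, isClosedOrbitProjection_orbitMap hcl, ?_⟩
  let _ : TopologicalSpace (ClosedOrbit (specialUnitary h) (semistableIsotropic h 3)) :=
    TopologicalSpace.coinduced q inferInstance
  obtain ⟨σ, hσc, hσ⟩ := hh.exists_continuous_rightInverse_toHalfCircle hp hn0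
  have hqs : Function.Surjective q := orbitMap_surjective hcl
  have hq_iff : ∀ x y, q x = q y ↔ hh.toHalfCircle hp hn0 x = hh.toHalfCircle hp hn0 y := by
    intro x y
    rw [hq, orbitMap_eq_iff, hh.mem_orbit_iff hp hn0, Subtype.ext_iff, Circle.ext_iff]
    rfl
  have he : ∀ x, hh.toHalfCircle hp hn0 (Function.surjInv hqs (q x)) = hh.toHalfCircle hp hn0 x :=
    fun x => (hq_iff _ _).mp (Function.surjInv_eq hqs _)
  have hqc : Continuous q := continuous_coinduced_rng
  refine ⟨{ toFun := fun O => hh.toHalfCircle hp hn0 (Function.surjInv hqs O)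
            invFun := fun u => q (σ u)
            left_inv := fun O => by
              obtain ⟨x, rfl⟩ := hqs O
              exact (hq_iff _ _).mpr ((hσ _).trans (he x))
            right_inv := fun u => (he (σ u)).trans (hσ u)
            continuous_toFun := ?_
            continuous_invFun := hqc.comp hσc }, fun x v hv =>
      ⟨hh.tripleProduct_ne_zero hp hn0 x hv, ?_⟩⟩
  · exact continuous_coinduced_dom.mpr
      ((hh.continuous_toHalfCircle hp hn0).congr fun x => (he x).symm)
  · exact (congrArg (fun u : halfCircle => ((u : Circle) : ℂ)) (he x)).trans
      (hv.angularInvariant_eq h)
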